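/- All graphs are finite and simple. A graph $F$ is \emph{$2$-acyclic} if there is a set of exactly two vertices of $F$ whose deletion leaves a forest. A graph $G$ is \emph{$F$-free} if no (not necessarily induced) subgraph of $G$ is isomorphic to $F$. The \emph{acyclic chromatic number} $\chi_a(G)$ is the least $k$ such that $G$ has a proper $k$-colouring in which every two colour classes induce a forest. \textbf{Theorem.} There are an absolute constant $C>0$ and a function $g\colon\mathbb{N}\to\mathbb{R}$ with $g(\Delta)=o(\Delta)$ as $\Delta\to\infty$ such that the following holds. Let $F$ be a $2$-acyclic bipartite graph on $t\ge 2$ vertices. Then every $F$-free graph $G$ of maximum degree $\Delta>t$ satisfies \[ \chi_a(G)\le C\,t^{1/4}\Delta^{5/4}\qquad\text{and}\qquad \chi_a(G)<4.3948\,t^{1/4}\Delta^{5/4}+\Delta+g(\Delta). \] Moreover, for every $s\ge 0$ the complete bipartite graph $K_{3,s}$ is bipartite and $2$-acyclic, and there is an absolute constant $C'>0$ such that, for every $s\ge 1$, every $K_{3,s}$-free graph $G$ of maximum degree $\Delta>s+3$ satisfies $\chi_a(G)\le C'\,s^{1/4}\Delta^{5/4}$. -/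

import Mathlib

universe u v

namespace SimpleGraph

/-- A set `X` of vertices is a feedback vertex set of `G` if `G ∖ X` is a forest. -/
def IsFeedbackVertexSet {V : Type u} (G : SimpleGraph V) (X : Finset V) : Prop :=
  (G.induce {x : V | x ∉ X}).IsAcyclic

/-- A graph is `k`-acyclic if it has a feedback vertex set of size `k`. -/
def IsKAcyclic {V : Type u} (G : SimpleGraph V) (k : ℕ) : Prop :=
  ∃ X : Finset V, X.card = k ∧ G.IsFeedbackVertexSet X

/-- A proper colouring is acyclic if every pair of colour classes induces a forest. -/
def Coloring.IsAcyclicColoring {V : Type u} {G : SimpleGraph V} {α : Type v}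
    (φ : G.Coloring α) : Prop :=
  ∀ a b : α, (G.induce {x : V | φ x = a ∨ φ x = b}).IsAcyclic

/-- `G` has an acyclic colouring with `k` colours. -/
def AcyclicColorable {V : Type u} (G : SimpleGraph V) (k : ℕ) : Prop :=
  ∃ φ : G.Coloring (Fin k), φ.IsAcyclicColoring

/-- The acyclic chromatic number: the minimum `k` such that `G` has an acyclic `k`-colouring.
For finite graphs the minimum exists, see `acyclicColorable_acyclicChromaticNumber`. -/
noncomputable def acyclicChromaticNumber {V : Type u} (G : SimpleGraph V) : ℕ :=
  sInf {k : ℕ | G.AcyclicColorable k}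

theorem isAcyclic_induce_of_injective {V : Type u} {α : Type v} (G : SimpleGraph V)
    (f : V → α) (hf : Function.Injective f) (a b : α) :
    (G.induce {x : V | f x = a ∨ f x = b}).IsAcyclic := by
  classical
  intro x c hc
  have h3 := hc.three_le_length
  have hinj : Function.Injective
      (fun y : ↑{x : V | f x = a ∨ f x = b} => f y.1) :=
    fun y z h => Subtype.ext (hf h)
  have hn := hc.support_nodup.map hinj
  have hsub : (c.support.tail.map
      (fun y : ↑{x : V | f x = a ∨ f x = b} => f y.1)).toFinset ⊆ {a, b} := by
    intro i hi
    rw [List.mem_toFinset, List.mem_map] at hi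
    obtain ⟨y, -, rfl⟩ := hi
    have hy : f y.1 = a ∨ f y.1 = b := y.2
    rw [Finset.mem_insert, Finset.mem_singleton]
    exact hy
  have h1 := Finset.card_le_card hsub
  rw [List.toFinset_card_of_nodup hn, List.length_map] at h1
  have h2 : ({a, b} : Finset α).card ≤ 2 := Finset.card_le_two
  have hlen : c.support.tail.length = c.length := by simp
  omega

theorem acyclicColorable_card {V : Type u} [Fintype V] (G : SimpleGraph V) :
    G.AcyclicColorable (Fintype.card V) :=
  ⟨Coloring.mk (Fintype.equivFin V)
      (fun {_ _} h hxy => h.ne ((Fintype.equivFin V).injective hxy)),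
    fun a b => G.isAcyclic_induce_of_injective _ (Fintype.equivFin V).injective a b⟩

theorem acyclicColorable_acyclicChromaticNumber {V : Type u} [Fintype V] (G : SimpleGraph V) :
    G.AcyclicColorable G.acyclicChromaticNumber :=
  Nat.sInf_mem (s := {k : ℕ | G.AcyclicColorable k}) ⟨_, G.acyclicColorable_card⟩

end SimpleGraph

/-! Acyclic colourings are counted, not constructed. For `v ∉ S` the induction shows that `insert v
S` has at least `β` times as many acyclic `k`-colourings as `S`, so the whole graph has one. Few of
the `k` extensions of the colourings of `S` fail. A neighbour of `v` with the colour of `v` spoils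
at most as many extensions as `S` has colourings. On a bichromatic cycle of length `2j+4` through
`v`, the colours of `v` and of `2j+1` vertices of `S` can be forgotten and recovered, so by
induction that cycle spoils at most a `β^-(2j+1)` multiple of that number. Hence `k ≥ D + β + ∑ B j
/ β^(2j+1)` suffices, where `D` bounds the degrees and `B j` bounds the paths of length `2j+3` from
a vertex that close up to a cycle (`mul_card_acyclicColoringsOn_le`).

With `s = t^(1/4) D^(5/4)` and `β = 2s`, the trivial `B j = D^(2j+3)` is good enough for `j ≥ 1`.
Only four-cycles need `F`: at most `2s² = 2√(t D⁵)` ordered ones start at a vertex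
(`Free.card_fourCycleTriples_sq_le`). Let `F` minus `{x, y}` be a forest. Forests embed greedily
into bipartite patterns of large minimum degree, so a pattern whose sides lie in the neighbourhoods
of candidate images of `x` and `y` has few edges (`Free.sum_card_filter_adj_le`). If `x` and `y` are
on opposite sides of `F`, this bounds the four-cycles through each edge. If they are on the same
side, it bounds second moments of triple codegrees, and double counting with Cauchy–Schwarz
finishes. -/

/-! ### Forests in dense bipartite patterns -/

theorem SimpleGraph.IsAcyclic.exists_adj_unique {V : Type*} [Finite V] [Nonempty V]
    {G : SimpleGraph V} (h : G.IsAcyclic) : ∃ v, ∀ a b, G.Adj v a → G.Adj v b → a = b := by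
  -- The end of a longest path: a neighbour off the path would extend it, and one on the path other
  -- than the penultimate vertex would close a cycle.
  obtain ⟨u, v, p, hp, hmax⟩ := SimpleGraph.Walk.exists_isPath_forall_isPath_length_le_length G
  have key : ∀ w, G.Adj v w → w = p.penultimate := by
    intro w hw
    refine h.eq_penultimate_of_adj_end hp hw ?_
    by_contra hns
    have := hmax _ _ _ (hp.concat hns hw)
    simp at this
  exact ⟨v, fun a b ha hb => (key a ha).trans (key b hb).symm⟩

namespace SimpleGraph

open Finset

variable {V W : Type*}

/-- A forest with a proper two-colouring embeds into a bipartite pattern of large minimum degree,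
respecting the sides. -/
theorem IsAcyclic.exists_embedding_of_le_card [DecidableEq V] {T : SimpleGraph W} {G : SimpleGraph V}
    [DecidableRel G.Adj] (κ : T.Coloring (Fin 2)) (P : Fin 2 → Finset V) (n : ℕ)
    (hne : ∀ i, (P i).Nonempty) (hdeg : ∀ i, ∀ z ∈ P i, n ≤ #{w ∈ P (1 - i) | G.Adj z w})
    (A : Finset W) (hT : (T.induce (A : Set W)).IsAcyclic) (hA : #A ≤ n) :
    ∃ φ : W → V, Set.InjOn φ A ∧ (∀ a ∈ A, φ a ∈ P (κ a)) ∧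
      ∀ a ∈ A, ∀ b ∈ A, T.Adj a b → G.Adj (φ a) (φ b) := by
  classical
  induction hm : #A generalizing A with
  | zero =>
    rw [card_eq_zero] at hm
    subst hm
    exact ⟨fun _ => (hne 0).choose, by simp⟩
  | succ m ih =>
    have hAne : A.Nonempty := card_pos.mp (by omega)
    have : Nonempty (A : Set W) := hAne.to_subtype
    obtain ⟨⟨a, ha⟩, huniq⟩ := hT.exists_adj_unique
    have haA : a ∈ A := ha
    have hcard : #(A.erase a) = m := by rw [card_erase_of_mem haA]; omega
    have hsub : ((A.erase a : Finset W) : Set W) ⊆ A := by simp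
    obtain ⟨φ, hinj, hP, hadj⟩ := ih (A.erase a)
      (hT.comap (induceHomOfLE T hsub).toHom (induceHomOfLE T hsub).injective) (by omega) hcard
    -- `a` has at most one neighbour already embedded, so at least `n` positions respect its edges,
    -- while fewer than `n` are occupied.
    obtain ⟨N, hNP, hNn, hNadj⟩ : ∃ N ⊆ P (κ a), n ≤ #N ∧
        ∀ b ∈ A.erase a, T.Adj a b → ∀ w ∈ N, G.Adj (φ b) w := by
      by_cases hb : ∃ b ∈ A.erase a, T.Adj a b
      · obtain ⟨b, hbA, hab⟩ := hb
        have hκ : 1 - κ b = κ a := by have := κ.valid hab; omega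
        refine ⟨{w ∈ P (κ a) | G.Adj (φ b) w}, filter_subset _ _, ?_, ?_⟩
        · rw [← hκ]; exact hdeg _ _ (hP b hbA)
        · intro c hc hac w hw
          have : b = c := congrArg Subtype.val
            (huniq ⟨b, mem_of_mem_erase hbA⟩ ⟨c, mem_of_mem_erase hc⟩ hab hac)
          rw [← this]; exact (mem_filter.mp hw).2
      · obtain ⟨z, hz⟩ := hne (1 - κ a)
        have hκ : 1 - (1 - κ a) = κ a := by omega
        refine ⟨P (κ a), subset_rfl, ?_, fun b hb' hab => absurd ⟨b, hb', hab⟩ hb⟩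
        have := hdeg _ _ hz
        rw [hκ] at this
        exact this.trans (card_filter_le _ _)
    obtain ⟨w, hwN, hw⟩ : ∃ w ∈ N, w ∉ (A.erase a).image φ := by
      refine exists_mem_notMem_of_card_lt_card ?_
      have := card_image_le (s := A.erase a) (f := φ)
      omega
    have hne' : ∀ b ∈ A, b ≠ a → b ∈ A.erase a := fun b hb hba => mem_erase.mpr ⟨hba, hb⟩
    have hw' : ∀ b ∈ A, b ≠ a → φ b ≠ w := fun b hb hba h =>
      hw (mem_image.mpr ⟨b, hne' b hb hba, h⟩)
    refine ⟨Function.update φ a w, ?_, ?_, ?_⟩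
    · intro b hb c hc hbc
      by_cases h1 : b = a <;> by_cases h2 : c = a
      · rw [h1, h2]
      · subst h1; simp [h2] at hbc; exact absurd hbc.symm (hw' c hc h2)
      · subst h2; simp [h1] at hbc; exact absurd hbc (hw' b hb h1)
      · simp [h1, h2] at hbc; exact hinj (hne' b hb h1) (hne' c hc h2) hbc
    · intro b hb
      by_cases h1 : b = a
      · subst h1; simpa using hNP hwN
      · simpa [h1] using hP b (hne' b hb h1)
    · intro b hb c hc hbc
      by_cases h1 : b = a <;> by_cases h2 : c = a
      · subst h1; subst h2; exact absurd hbc (T.loopless.irrefl _)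
      · subst h1; simpa [h2] using (hNadj c (hne' c hc h2) hbc w hwN).symm
      · subst h2; simpa [h1] using hNadj b (hne' b hb h1) hbc.symm w hwN
      · simpa [h1, h2] using hadj b (hne' b hb h1) c (hne' c hc h2) hbc

theorem sum_card_filter_adj_comm (G : SimpleGraph V) [DecidableRel G.Adj] (A B : Finset V) :
    ∑ z ∈ A, #{w ∈ B | G.Adj z w} = ∑ z ∈ B, #{w ∈ A | G.Adj z w} := by
  have := sum_card_bipartiteAbove_eq_sum_card_bipartiteBelow (s := A) (t := B) G.Adj
  simp only [bipartiteAbove, bipartiteBelow] at this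
  rw [this]
  simp only [G.adj_comm]

/-- A dense bipartite pattern contains one of large minimum degree. -/
theorem exists_subpattern_of_lt_sum [DecidableEq V] (G : SimpleGraph V) [DecidableRel G.Adj] (r : ℕ)
    (A B : Finset V) (h : r * (#A + #B) < ∑ z ∈ A, #{w ∈ B | G.Adj z w}) :
    ∃ A' ⊆ A, ∃ B' ⊆ B, A'.Nonempty ∧ B'.Nonempty ∧
      (∀ z ∈ A', r < #{w ∈ B' | G.Adj z w}) ∧ ∀ z ∈ B', r < #{w ∈ A' | G.Adj z w} := by
  induction hm : #A + #B using Nat.strong_induction_on generalizing A B with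
  | _ m ih =>
    -- Deleting a vertex of degree at most `r` costs at most `r` edges and lowers the other side by
    -- exactly `r`, so the strict inequality survives.
    by_cases h1 : ∃ z ∈ A, #{w ∈ B | G.Adj z w} ≤ r
    · obtain ⟨z, hz, hzr⟩ := h1
      have hs := add_sum_erase A (fun z => #{w ∈ B | G.Adj z w}) hz
      have hc := card_erase_add_one hz
      have h' : r * (#(A.erase z) + #B) < ∑ z ∈ A.erase z, #{w ∈ B | G.Adj z w} := by
        have : r * (#A + #B) = r * (#(A.erase z) + #B) + r := by rw [← hc]; ring
        omega
      obtain ⟨A', hA', B', hB', H⟩ := ih _ (by omega) _ _ h' rfl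
      exact ⟨A', hA'.trans (erase_subset _ _), B', hB', H⟩
    by_cases h2 : ∃ z ∈ B, #{w ∈ A | G.Adj z w} ≤ r
    · obtain ⟨z, hz, hzr⟩ := h2
      rw [sum_card_filter_adj_comm] at h
      have hs := add_sum_erase B (fun z => #{w ∈ A | G.Adj z w}) hz
      have hc := card_erase_add_one hz
      have h' : r * (#A + #(B.erase z)) < ∑ a ∈ A, #{w ∈ B.erase z | G.Adj a w} := by
        rw [sum_card_filter_adj_comm]
        have : r * (#A + #B) = r * (#A + #(B.erase z)) + r := by rw [← hc]; ring
        omega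
      obtain ⟨A', hA', B', hB', H⟩ := ih _ (by omega) _ _ h' rfl
      exact ⟨A', hA', B', hB'.trans (erase_subset _ _), H⟩
    push Not at h1 h2
    refine ⟨A, subset_rfl, B, subset_rfl, ?_, ?_, h1, h2⟩
    · by_contra hA; simp only [not_nonempty_iff_eq_empty] at hA; subst hA; simp at h
    · by_contra hB; simp only [not_nonempty_iff_eq_empty] at hB; subst hB; simp at h

/-- If `F` minus `{x, y}` is a forest and `F ⊄ G`, then a bipartite pattern in the common
neighbourhoods of two candidate images of `x` and `y` is sparse. -/
theorem Free.sum_card_filter_adj_le [Fintype W] [DecidableEq W] [DecidableEq V]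
    {F : SimpleGraph W} {G : SimpleGraph V}
    [DecidableRel G.Adj] (hF : F.Free G) (κ : F.Coloring (Fin 2)) {x y : W} (hxy : x ≠ y)
    (hac : F.IsFeedbackVertexSet {x, y}) {r : ℕ} (hr : Fintype.card W ≤ r + 1)
    {u v : V} (huv : u ≠ v) (P : Fin 2 → Finset V) (hu : ∀ i, u ∉ P i) (hv : ∀ i, v ∉ P i)
    (hPu : ∀ w ∈ P (1 - κ x), G.Adj u w) (hPv : ∀ w ∈ P (1 - κ y), G.Adj v w)
    (hadj : κ x ≠ κ y → G.Adj u v) :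
    ∑ z ∈ P 0, #{w ∈ P 1 | G.Adj z w} ≤ r * (#(P 0) + #(P 1)) := by
  by_contra! hlt
  obtain ⟨A, hA, B, hB, hAne, hBne, hAd, hBd⟩ := G.exists_subpattern_of_lt_sum r _ _ hlt
  set Q : Fin 2 → Finset V := ![A, B] with hQ
  have hQP : ∀ i, Q i ⊆ P i := by intro i; fin_cases i <;> simpa [hQ]
  obtain ⟨φ, hinj, hφ, hφadj⟩ := IsAcyclic.exists_embedding_of_le_card κ Q r
    (by intro i; fin_cases i <;> simpa [hQ])
    (by
      intro i; fin_cases i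
      · intro z hz; exact (hAd z hz).le
      · intro z hz; exact (hBd z hz).le)
    (univ \ {x, y}) (by
      have : ((univ \ {x, y} : Finset W) : Set W) = {w | w ∉ ({x, y} : Finset W)} := by ext; simp
      rw [this]; exact hac)
    (by rw [card_sdiff_of_subset (subset_univ _), card_pair hxy, card_univ]; omega)
  have hmem : ∀ w, w ≠ x → w ≠ y → w ∈ univ \ ({x, y} : Finset W) := by
    intro w h1 h2; simp [h1, h2]
  have hφP : ∀ w, w ≠ x → w ≠ y → φ w ∈ P (κ w) := fun w h1 h2 => hQP _ (hφ w (hmem w h1 h2))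
  have hφu : ∀ w, w ≠ x → w ≠ y → φ w ≠ u := fun w h1 h2 h => hu _ (h ▸ hφP w h1 h2)
  have hφv : ∀ w, w ≠ x → w ≠ y → φ w ≠ v := fun w h1 h2 h => hv _ (h ▸ hφP w h1 h2)
  -- Sending `x` to `u` and `y` to `v` completes the embedded forest to a copy of `F`; `hadj` is
  -- needed only when `x` and `y` may be adjacent.
  let ψ : W → V := fun w => if w = x then u else if w = y then v else φ w
  have ψx : ψ x = u := by simp [ψ]
  have ψy : ψ y = v := by simp [ψ, hxy.symm]
  have ψo : ∀ w, w ≠ x → w ≠ y → ψ w = φ w := fun w h1 h2 => by simp [ψ, h1, h2]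
  have hxw : ∀ w, w ≠ x → w ≠ y → F.Adj x w → G.Adj u (φ w) := by
    intro w h1 h2 h
    refine hPu _ ?_
    have : 1 - κ x = κ w := by have := κ.valid h; omega
    rw [this]; exact hφP w h1 h2
  have hyw : ∀ w, w ≠ x → w ≠ y → F.Adj y w → G.Adj v (φ w) := by
    intro w h1 h2 h
    refine hPv _ ?_
    have : 1 - κ y = κ w := by have := κ.valid h; omega
    rw [this]; exact hφP w h1 h2
  refine hF ⟨⟨⟨ψ, ?_⟩, ?_⟩⟩
  · intro a b hab
    have hab' := hab.ne
    rcases eq_or_ne a x with rfl | hax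
    · rcases eq_or_ne b y with rfl | hby
      · rw [ψx, ψy]; exact hadj (κ.valid hab)
      · rw [ψx, ψo b hab'.symm hby]; exact hxw b hab'.symm hby hab
    rcases eq_or_ne a y with rfl | hay
    · rcases eq_or_ne b x with rfl | hbx
      · rw [ψx, ψy]; exact (hadj (κ.valid hab.symm)).symm
      · rw [ψy, ψo b hbx hab'.symm]; exact hyw b hbx hab'.symm hab
    rw [ψo a hax hay]
    rcases eq_or_ne b x with rfl | hbx
    · rw [ψx]; exact (hxw a hax hay hab.symm).symm
    rcases eq_or_ne b y with rfl | hby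
    · rw [ψy]; exact (hyw a hax hay hab.symm).symm
    rw [ψo b hbx hby]
    exact hφadj a (hmem a hax hay) b (hmem b hbx hby) hab
  · intro a b hab
    change ψ a = ψ b at hab
    have H : ∀ w, w ≠ x → w ≠ y → ψ w ≠ u ∧ ψ w ≠ v := fun w h1 h2 => by
      rw [ψo w h1 h2]; exact ⟨hφu w h1 h2, hφv w h1 h2⟩
    have I : ∀ a b, a ≠ x → a ≠ y → b ≠ x → b ≠ y → ψ a = ψ b → a = b := by
      intro a b h1 h2 h3 h4 h
      rw [ψo a h1 h2, ψo b h3 h4] at h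
      exact hinj (mem_coe.mpr (hmem a h1 h2)) (mem_coe.mpr (hmem b h3 h4)) h
    by_cases hax : a = x
    · subst hax
      by_contra hba
      by_cases hby : b = y
      · subst hby; exact huv (ψx.symm.trans (hab.trans ψy))
      · exact (H b (Ne.symm hba) hby).1 (hab.symm.trans ψx)
    by_cases hay : a = y
    · subst hay
      by_contra hba
      by_cases hbx : b = x
      · subst hbx; exact huv (ψx.symm.trans (hab.symm.trans ψy))
      · exact (H b hbx (Ne.symm hba)).2 (hab.symm.trans ψy)
    by_cases hbx : b = x
    · subst hbx; exact absurd (hab.trans ψx) (H a hax hay).1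
    by_cases hby : b = y
    · subst hby; exact absurd (hab.trans ψy) (H a hax hay).2
    exact I a b hax hay hbx hby hab

end SimpleGraph

/-! ### Second moments and double counting -/

open Finset in
-- Values up to `r` satisfy `f² ≤ r f`. For the larger ones `(d - f)(f - r) ≥ 0` gives `f² + r d ≤ r
-- f + d f`; on summing, the terms `r d` cancel the count of large values in `h`.
theorem Finset.sum_sq_le_of_sum_filter_lt_le {ι : Type*} (s : Finset ι) (f : ι → ℕ) {r d m : ℕ}
    (hf : ∀ i ∈ s, f i ≤ d) (hm : ∑ i ∈ s, f i ≤ m)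
    (h : ∑ i ∈ s with r < f i, f i ≤ r * (d + #{i ∈ s | r < f i})) :
    ∑ i ∈ s, f i ^ 2 ≤ r * m + r * d ^ 2 := by
  have key : ∀ i ∈ s, f i ^ 2 + (if r < f i then r * d else 0) ≤
      r * f i + (if r < f i then d * f i else 0) := by
    intro i hi
    have := hf i hi
    split_ifs with h1
    · nlinarith [mul_le_mul' (Nat.sub_le d (f i)) (le_refl r), Nat.sub_add_cancel this,
        Nat.sub_add_cancel h1.le, Nat.zero_le ((d - f i) * (f i - r))]
    · push Not at h1
      nlinarith
  have h1 := sum_le_sum key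
  simp only [sum_add_distrib, ← sum_filter, sum_const, smul_eq_mul, ← mul_sum] at h1
  have h2 := Nat.mul_le_mul_left r hm
  have h3 := Nat.mul_le_mul_left d h
  nlinarith

open Finset in
-- Both sides count, with weights, the four-cycles `a, u, b, w` between `A` and `U`.
theorem Finset.sum_sum_sq_sum_mul_comm {α β : Type*} (A : Finset α) (U : Finset β) (x : α → β → ℕ) :
    ∑ a ∈ A, ∑ b ∈ A, (∑ u ∈ U, x a u * x b u) ^ 2 =
      ∑ u ∈ U, ∑ w ∈ U, (∑ a ∈ A, x a u * x a w) ^ 2 := by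
  simp only [pow_two, sum_mul_sum]
  calc _ = ∑ a ∈ A, ∑ u ∈ U, ∑ b ∈ A, ∑ w ∈ U, x a u * x b u * (x a w * x b w) :=
        sum_congr rfl fun a _ => sum_comm
    _ = ∑ u ∈ U, ∑ a ∈ A, ∑ b ∈ A, ∑ w ∈ U, x a u * x b u * (x a w * x b w) := sum_comm
    _ = ∑ u ∈ U, ∑ a ∈ A, ∑ w ∈ U, ∑ b ∈ A, x a u * x b u * (x a w * x b w) :=
        sum_congr rfl fun u _ => sum_congr rfl fun a _ => sum_comm
    _ = ∑ u ∈ U, ∑ w ∈ U, ∑ a ∈ A, ∑ b ∈ A, x a u * x b u * (x a w * x b w) :=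
        sum_congr rfl fun u _ => sum_comm
    _ = _ := by
        refine sum_congr rfl fun u _ => sum_congr rfl fun w _ => sum_congr rfl fun a _ =>
          sum_congr rfl fun b _ => by ring

/-! ### Four-cycles through a vertex -/

namespace SimpleGraph

open Finset

variable {V W : Type*}

/-- The triples `(a, u, b)` for which `v, a, u, b` is a four-cycle. -/
def fourCycleTriples [Fintype V] [DecidableEq V] (G : SimpleGraph V) [DecidableRel G.Adj] (v : V) :
    Finset (V × V × V) :=
  {p | G.Adj v p.1 ∧ G.Adj p.1 p.2.1 ∧ G.Adj p.2.1 p.2.2 ∧ G.Adj p.2.2 v ∧ v ≠ p.2.1 ∧ p.1 ≠ p.2.2}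

theorem sum_card_filter_adj_le_mul [Fintype V] (G : SimpleGraph V) [DecidableRel G.Adj] {D : ℕ}
    (hD : ∀ v, G.degree v ≤ D) (A B : Finset V) :
    ∑ z ∈ A, #{w ∈ B | G.Adj z w} ≤ #A * D := by
  classical
  refine (sum_le_card_nsmul _ _ D fun z _ => ?_).trans_eq (by simp)
  refine le_trans (card_le_card fun w hw => ?_) (hD z)
  simpa using (mem_filter.mp hw).2

section FourCycles

variable [Fintype V] [DecidableEq V] [Fintype W] [DecidableEq W] {F : SimpleGraph W}
  {G : SimpleGraph V} [DecidableRel G.Adj] {D r : ℕ} {x y : W}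

/-- For fixed `a`, the four-cycles through the edge `va` are the edges of the pattern between `N(v)
\ a` and `N(a) \ v`. Since `v` and `a` are adjacent, they can serve as images of `x` and `y`, so the
pattern is sparse. -/
theorem Free.card_fourCycleTriples_le_of_ne (hF : F.Free G) (κ : F.Coloring (Fin 2))
    (hκ : κ x ≠ κ y) (hac : F.IsFeedbackVertexSet {x, y}) (hr : Fintype.card W ≤ r + 1)
    (hD : ∀ v, G.degree v ≤ D) (v : V) :
    #(G.fourCycleTriples v) ≤ D * (r * (D + D)) := by
  have hxy : x ≠ y := fun h => hκ (by rw [h])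
  have hmaps : Set.MapsTo (fun p : V × V × V => p.1) (G.fourCycleTriples v)
      (G.neighborFinset v) := by
    intro p hp
    simp only [fourCycleTriples, coe_filter, mem_univ, true_and, Set.mem_ofPred_eq] at hp
    simpa using hp.1
  rw [card_eq_sum_card_fiberwise hmaps]
  refine (sum_le_card_nsmul _ _ (r * (D + D)) fun a ha => ?_).trans
    (by rw [smul_eq_mul]; exact Nat.mul_le_mul_right _ (hD v))
  have hva : G.Adj v a := by simpa using ha
  calc #{p ∈ G.fourCycleTriples v | p.1 = a}
      ≤ #(((G.neighborFinset v).erase a).sigma fun b =>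
          {u ∈ (G.neighborFinset a).erase v | G.Adj b u}) := by
        refine card_le_card_of_injOn (fun p => ⟨p.2.2, p.2.1⟩) ?_ ?_
        · rintro ⟨a', u, b⟩ hp
          simp only [fourCycleTriples, coe_filter, mem_filter, mem_univ, true_and,
            Set.mem_ofPred_eq] at hp
          obtain ⟨⟨h1, h2, h3, h4, h5, h6⟩, rfl⟩ := hp
          simp [h2, h3.symm, h4.symm, h5.symm, h6.symm]
        · rintro ⟨a', u, b⟩ hp ⟨a'', u', b'⟩ hp' h
          simp only [coe_filter, Set.mem_ofPred_eq] at hp hp'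
          simp at h
          simp [hp.2, hp'.2, h]
    _ = ∑ b ∈ (G.neighborFinset v).erase a, #{u ∈ (G.neighborFinset a).erase v | G.Adj b u} :=
        card_sigma _ _
    _ ≤ r * (#((G.neighborFinset v).erase a) + #((G.neighborFinset a).erase v)) := by
        set P : Fin 2 → Finset V := fun i =>
          if i = κ y then (G.neighborFinset v).erase a else (G.neighborFinset a).erase v with hP
        have hx1 : 1 - κ x = κ y := by omega
        have hy1 : 1 - κ y ≠ κ y := by omega
        have := hF.sum_card_filter_adj_le κ hxy hac hr hva.ne P
          (by intro i; simp only [hP]; split_ifs <;> simp)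
          (by intro i; simp only [hP]; split_ifs <;> simp)
          (by intro w hw; simp only [hP, hx1, if_true] at hw; simpa using mem_of_mem_erase hw)
          (by intro w hw; simp only [hP, hy1, if_false] at hw; simpa using mem_of_mem_erase hw)
          (fun _ => hva)
        have h01 : κ y = 0 ∨ κ y = 1 := by omega
        rcases h01 with h0 | h1
        · simpa [hP, h0] using this
        · rw [sum_card_filter_adj_comm]
          simp only [hP, h1] at this
          simpa [add_comm] using this
    _ ≤ r * (D + D) := by
        refine Nat.mul_le_mul_left _ (add_le_add ?_ ?_)
        · exact (card_erase_le).trans (hD v)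
        · exact (card_erase_le).trans (hD a)

/-- With `P` the common neighbourhood of `u` and `v`, both can serve as images of `x` and `y`, and
vertices with more than `r` neighbours in `P` form the other side of a sparse pattern. This is the
hypothesis on large values in `sum_sq_le_of_sum_filter_lt_le`. -/
theorem Free.sum_codegree_sq_le (hF : F.Free G) (κ : F.Coloring (Fin 2)) (hxy : x ≠ y)
    (hκ : κ x = κ y) (hac : F.IsFeedbackVertexSet {x, y}) (hr : Fintype.card W ≤ r + 1)
    (hD : ∀ v, G.degree v ≤ D) {v u : V} (huv : u ≠ v) :
    ∑ w ∈ univ.erase v, #{a ∈ G.neighborFinset v | G.Adj u a ∧ G.Adj w a} ^ 2 ≤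
      #{a ∈ G.neighborFinset v | G.Adj u a} * (D * (2 * r + 1)) := by
  set P := {a ∈ G.neighborFinset v | G.Adj u a} with hPdef
  have hf : ∀ w, #{a ∈ G.neighborFinset v | G.Adj u a ∧ G.Adj w a} = #{a ∈ P | G.Adj w a} := by
    intro w; rw [hPdef, filter_filter]
  simp only [hf]
  have hPD : #P ≤ D := (card_filter_le _ _).trans (hD v)
  have huU : u ∈ univ.erase v := by simp [huv]
  -- The term `w = u` equals `#P ^ 2` and is split off, since `u` must stay outside the pattern.
  rw [← add_sum_erase _ _ huU]
  have hu : #{a ∈ P | G.Adj u a} = #P := by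
    rw [hPdef, filter_filter]; simp
  have hsum : ∑ w ∈ (univ.erase v).erase u, #{a ∈ P | G.Adj w a} ≤ #P * D := by
    rw [sum_card_filter_adj_comm]
    exact G.sum_card_filter_adj_le_mul hD _ _
  have hmain := sum_sq_le_of_sum_filter_lt_le ((univ.erase v).erase u)
    (fun w => #{a ∈ P | G.Adj w a}) (r := r) (d := #P) (fun w _ => card_filter_le _ _) hsum (by
      set S := {w ∈ (univ.erase v).erase u | r < #{a ∈ P | G.Adj w a}} with hS
      -- Neighbours of `x` and of `y` all lie on the side opposite to `κ y`, so only that side has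
      -- to consist of common neighbours.
      set Q : Fin 2 → Finset V := fun i => if i = κ y then S else P with hQ
      have hy1 : 1 - κ y ≠ κ y := by omega
      have hmemP : ∀ w ∈ P, G.Adj u w ∧ G.Adj v w := by
        intro w hw
        simp only [hPdef, mem_filter, mem_neighborFinset] at hw
        exact hw.symm
      have huS : u ∉ S := by simp [hS]
      have hvS : v ∉ S := by simp [hS]
      have huP : u ∉ P := fun h => G.loopless.irrefl _ (hmemP u h).1
      have hvP : v ∉ P := fun h => G.loopless.irrefl _ (hmemP v h).2
      have := hF.sum_card_filter_adj_le κ hxy hac hr huv Q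
        (by intro i; simp only [hQ]; split_ifs <;> assumption)
        (by intro i; simp only [hQ]; split_ifs <;> assumption)
        (by intro w hw; simp only [hQ, hκ, hy1, if_false] at hw; exact (hmemP w hw).1)
        (by intro w hw; simp only [hQ, hy1, if_false] at hw; exact (hmemP w hw).2)
        (fun h => absurd hκ h)
      have h01 : κ y = 0 ∨ κ y = 1 := by omega
      rcases h01 with h0 | h1
      · simpa [hQ, h0, add_comm] using this
      · rw [sum_card_filter_adj_comm]
        simpa [hQ, h1] using this)
  rw [hu]
  nlinarith [Nat.mul_le_mul_left (#P) hPD, Nat.mul_le_mul_left (r * #P) hPD]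

/-- Four-cycles at `v` are counted by codegrees of pairs in `N(v)`. Cauchy–Schwarz passes to squared
codegrees, and exchanging the pairs `(a, b)` and `(u, w)` turns these into the sums bounded by
`sum_codegree_sq_le`. -/
theorem Free.card_fourCycleTriples_sq_le_of_eq (hF : F.Free G) (κ : F.Coloring (Fin 2))
    (hxy : x ≠ y) (hκ : κ x = κ y) (hac : F.IsFeedbackVertexSet {x, y})
    (hr : Fintype.card W ≤ r + 1) (hD : ∀ v, G.degree v ≤ D) (v : V) :
    #(G.fourCycleTriples v) ^ 2 ≤ D ^ 5 * (2 * r + 1) := by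
  set N := G.neighborFinset v with hN
  set U := univ.erase v with hU
  have hNadj : ∀ a, a ∈ N ↔ G.Adj v a := by simp [hN]
  let i : V → V → ℕ := fun a u => if G.Adj u a then 1 else 0
  have hii : ∀ a b u w, i a u * i b w = if G.Adj u a ∧ G.Adj w b then 1 else 0 := by
    intro a b u w; simp only [i]; split_ifs <;> simp_all
  have hmaps : Set.MapsTo (fun p : V × V × V => (p.1, p.2.2)) (G.fourCycleTriples v)
      ((N ×ˢ N : Finset (V × V)) : Set (V × V)) := by
    intro p hp
    simp only [fourCycleTriples, coe_filter, mem_univ, true_and, Set.mem_ofPred_eq] at hp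
    simpa [hNadj] using ⟨hp.1, hp.2.2.2.1.symm⟩
  have h1 : #(G.fourCycleTriples v) ≤ ∑ p ∈ N ×ˢ N, ∑ u ∈ U, i p.1 u * i p.2 u := by
    rw [card_eq_sum_card_fiberwise hmaps]
    refine sum_le_sum fun p _ => ?_
    simp only [hii, sum_boole, Nat.cast_id]
    refine card_le_card_of_injOn (fun q => q.2.1) ?_ ?_
    · rintro ⟨a, u, b⟩ hq
      simp only [fourCycleTriples, coe_filter, mem_filter, mem_univ, true_and,
        Set.mem_ofPred_eq] at hq
      obtain ⟨⟨h1, h2, h3, h4, h5, h6⟩, rfl⟩ := hq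
      simp [hU, h2.symm, h3, h5.symm]
    · rintro ⟨a, u, b⟩ hq ⟨a', u', b'⟩ hq' h
      simp only [coe_filter, Set.mem_ofPred_eq] at hq hq'
      obtain ⟨-, rfl⟩ := hq
      have := hq'.2
      simp_all
  have h2 : ∑ p ∈ N ×ˢ N, (∑ u ∈ U, i p.1 u * i p.2 u) ^ 2 ≤ D * D * (D * (2 * r + 1)) := by
    rw [sum_product, sum_sum_sq_sum_mul_comm N U i]
    simp only [hii, sum_boole, Nat.cast_id]
    calc _ ≤ ∑ u ∈ U, #{a ∈ N | G.Adj u a} * (D * (2 * r + 1)) :=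
          sum_le_sum fun u hu => hF.sum_codegree_sq_le κ hxy hκ hac hr hD (ne_of_mem_erase hu)
      _ = (∑ u ∈ U, #{a ∈ N | G.Adj u a}) * (D * (2 * r + 1)) := (sum_mul _ _ _).symm
      _ ≤ _ := by
          refine Nat.mul_le_mul_right _ ?_
          rw [sum_card_filter_adj_comm]
          exact (G.sum_card_filter_adj_le_mul hD _ _).trans (Nat.mul_le_mul_right _ (hD v))
  calc #(G.fourCycleTriples v) ^ 2 ≤ (∑ p ∈ N ×ˢ N, ∑ u ∈ U, i p.1 u * i p.2 u) ^ 2 :=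
        Nat.pow_le_pow_left h1 2
    _ ≤ #(N ×ˢ N) * ∑ p ∈ N ×ˢ N, (∑ u ∈ U, i p.1 u * i p.2 u) ^ 2 := sq_sum_le_card_mul_sum_sq
    _ ≤ (D * D) * (D * D * (D * (2 * r + 1))) := by
        rw [card_product]
        exact Nat.mul_le_mul (Nat.mul_le_mul (hD v) (hD v)) h2
    _ = _ := by ring

/-- In an `F`-free graph with `F` bipartite and `2`-acyclic, few four-cycles pass through a
vertex. -/
theorem Free.card_fourCycleTriples_sq_le (hF : F.Free G) (hbip : F.IsBipartite)
    (hac : F.IsKAcyclic 2) (hW : 1 ≤ Fintype.card W) (hWD : Fintype.card W ≤ D)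
    (hD : ∀ v, G.degree v ≤ D) (v : V) :
    #(G.fourCycleTriples v) ^ 2 ≤ 4 * Fintype.card W * D ^ 5 := by
  obtain ⟨κ⟩ := hbip
  obtain ⟨X, hX, hfvs⟩ := hac
  obtain ⟨x, y, hxy, rfl⟩ := card_eq_two.mp hX
  obtain ⟨r, hr⟩ := Nat.exists_eq_add_of_le' hW
  rw [hr] at hWD ⊢
  by_cases hκ : κ x = κ y
  · refine (hF.card_fourCycleTriples_sq_le_of_eq κ hxy hκ hfvs hr.le hD v).trans ?_
    rw [mul_comm (4 * (r + 1))]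
    exact Nat.mul_le_mul_left _ (by omega)
  -- This case gives `4 r² D⁴`; one factor `r` is traded for `D`, using `t ≤ D`.
  · calc #(G.fourCycleTriples v) ^ 2 ≤ (D * (r * (D + D))) ^ 2 :=
          Nat.pow_le_pow_left (hF.card_fourCycleTriples_le_of_ne κ hκ hfvs hr.le hD v) 2
      _ = 4 * r * D ^ 4 * r := by ring
      _ ≤ 4 * (r + 1) * D ^ 4 * D := by gcongr <;> omega
      _ = _ := by ring

end FourCycles

end SimpleGraph

/-! ### Paths that close up to cycles -/

namespace SimpleGraph

open Finset

section ClosablePaths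

variable {V : Type*} [Fintype V] [DecidableEq V] {G : SimpleGraph V} [DecidableRel G.Adj] {D : ℕ}

theorem sum_card_finsetWalkLength_le (hD : ∀ v, G.degree v ≤ D) (n : ℕ) (v : V) :
    ∑ w, #(G.finsetWalkLength n v w) ≤ D ^ n := by
  induction n generalizing v with
  | zero =>
    rw [sum_eq_single v]
    · simp [finsetWalkLength]
    · intro w _ hw
      simp [finsetWalkLength, hw.symm]
    · simp
  | succ n ih =>
    calc ∑ w, #(G.finsetWalkLength (n + 1) v w)
        ≤ ∑ w, ∑ x : G.neighborSet v, #(G.finsetWalkLength n x.1 w) := by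
          refine sum_le_sum fun w _ => ?_
          rw [finsetWalkLength]
          exact card_biUnion_le.trans (by simp)
      _ = ∑ x : G.neighborSet v, ∑ w, #(G.finsetWalkLength n x.1 w) := sum_comm
      _ ≤ ∑ x : G.neighborSet v, D ^ n := sum_le_sum fun x _ => ih x.1
      _ = G.degree v * D ^ n := by
          rw [sum_const, card_univ, G.card_neighborSet_eq_degree, smul_eq_mul]
      _ ≤ D ^ (n + 1) := by rw [pow_succ']; exact Nat.mul_le_mul_right _ (hD v)

open Classical in
/-- The paths of length `n` from `v` that close up to a cycle. -/
noncomputable def closablePaths (G : SimpleGraph V) [DecidableRel G.Adj] (n : ℕ) (v : V) :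
    Finset (Σ w, G.Walk v w) :=
  {p ∈ univ.sigma fun w => G.finsetWalkLength n v w | p.2.IsPath ∧ G.Adj p.1 v}

theorem mem_closablePaths {n : ℕ} {v : V} {p : Σ w, G.Walk v w} :
    p ∈ G.closablePaths n v ↔ p.2.length = n ∧ p.2.IsPath ∧ G.Adj p.1 v := by
  simp [closablePaths, mem_finsetWalkLength_iff]

theorem card_closablePaths_le (hD : ∀ v, G.degree v ≤ D) (n : ℕ) (v : V) :
    #(G.closablePaths n v) ≤ D ^ n := by
  refine (card_filter_le _ _).trans ?_
  rw [card_sigma]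
  exact sum_card_finsetWalkLength_le hD n v

theorem card_closablePaths_three_le (v : V) :
    #(G.closablePaths 3 v) ≤ #(G.fourCycleTriples v) := by
  refine card_le_card_of_injOn (fun p => (p.2.getVert 1, p.2.getVert 2, p.1)) ?_ ?_
  · rintro ⟨w, p⟩ hp
    obtain ⟨hl, hpath, hadj⟩ := mem_closablePaths.mp (mem_coe.mp hp)
    simp only at hl hpath hadj
    have h01 := p.adj_getVert_succ (i := 0) (by omega)
    have h12 := p.adj_getVert_succ (i := 1) (by omega)
    have h23 := p.adj_getVert_succ (i := 2) (by omega)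
    have h3 : p.getVert 3 = w := by rw [← hl]; exact p.getVert_length
    simp only [zero_add, Walk.getVert_zero, Nat.reduceAdd, h3] at h01 h12 h23
    have hinj := hpath.getVert_injOn
    simp only [fourCycleTriples, coe_filter, mem_univ, true_and, Set.mem_ofPred_eq]
    refine ⟨h01, h12, h23, hadj, ?_, ?_⟩
    · intro h
      have := @hinj 0 (by simp) 2 (by simp [hl]) (by simpa using h)
      omega
    · intro h
      have := @hinj 1 (by simp [hl]) 3 (by simp [hl]) (by rw [h3]; exact h)
      omega
  · rintro ⟨w, p⟩ hp ⟨w', q⟩ hq h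
    obtain ⟨hl, -⟩ := mem_closablePaths.mp (mem_coe.mp hp)
    obtain ⟨hl', -⟩ := mem_closablePaths.mp (mem_coe.mp hq)
    simp only [Prod.mk.injEq] at h hl hl'
    obtain ⟨h1, h2, rfl⟩ := h
    have : p = q := by
      refine Walk.ext_getVert_le_length (hl.trans hl'.symm) fun k hk => ?_
      rw [hl] at hk
      interval_cases k
      · simp
      · exact h1
      · exact h2
      · conv_lhs => rw [← hl]
        conv_rhs => rw [← hl']
        simp
    rw [this]

end ClosablePaths

/-! ### Counting partial acyclic colourings -/

section Counting

variable {V α : Type*} (G : SimpleGraph V)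

/-- `f` is a proper colouring on `S` without bichromatic cycles inside `S`. -/
def IsAcyclicColoringOn (S : Finset V) (f : V → α) : Prop :=
  (∀ a ∈ S, ∀ b ∈ S, G.Adj a b → f a ≠ f b) ∧
    ∀ (u : V) (c : G.Walk u u), c.IsCycle → (∀ x ∈ c.support, x ∈ S) →
      ∀ a b : α, ∃ x ∈ c.support, f x ≠ a ∧ f x ≠ b

variable {G}

theorem IsAcyclicColoringOn.mono {S T : Finset V} {f : V → α} (h : G.IsAcyclicColoringOn S f)
    (hTS : T ⊆ S) : G.IsAcyclicColoringOn T f :=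
  ⟨fun a ha b hb => h.1 a (hTS ha) b (hTS hb), fun u c hc hs => h.2 u c hc fun x hx => hTS (hs x hx)⟩

theorem IsAcyclicColoringOn.congr {S : Finset V} {f g : V → α} (h : G.IsAcyclicColoringOn S f)
    (hfg : ∀ x ∈ S, f x = g x) : G.IsAcyclicColoringOn S g := by
  refine ⟨fun a ha b hb hab => ?_, fun u c hc hs a b => ?_⟩
  · rw [← hfg a ha, ← hfg b hb]; exact h.1 a ha b hb hab
  · obtain ⟨x, hx, h1⟩ := h.2 u c hc hs a b
    exact ⟨x, hx, by rwa [← hfg x (hs x hx)]⟩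

theorem IsAcyclicColoringOn.isAcyclicColoring [Fintype V] {φ : G.Coloring α}
    (h : G.IsAcyclicColoringOn univ φ) : φ.IsAcyclicColoring := by
  intro a b u c hc
  obtain ⟨x, hx, h1, h2⟩ := h.2 _ (c.map (Embedding.induce _).toHom)
    (hc.map (Embedding.induce (G := G) _).injective) (fun _ _ => mem_univ _) a b
  rw [Walk.support_map, List.mem_map] at hx
  obtain ⟨y, -, rfl⟩ := hx
  exact y.2.elim h1 h2

/-- A bichromatic cycle through `v` is an even cycle along which two colours alternate. -/
theorem exists_closablePath_of_bichromatic [Fintype V] [DecidableEq V] [DecidableRel G.Adj]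
    {T : Finset V} {f : V → α} (hf : ∀ a ∈ T, ∀ b ∈ T, G.Adj a b → f a ≠ f b) {v : V}
    (c : G.Walk v v) (hc : c.IsCycle) (hT : ∀ x ∈ c.support, x ∈ T) (a b : α)
    (hab : ∀ x ∈ c.support, f x = a ∨ f x = b) :
    ∃ j, j < Fintype.card V ∧ ∃ p ∈ G.closablePaths (2 * j + 3) v, (∀ i, p.2.getVert i ∈ T) ∧
      ∀ i ≤ 2 * j + 3, f (p.2.getVert i) = if Even i then f v else f p.1 := by
  have h3 := hc.three_le_length
  have hmem : ∀ i, c.getVert i ∈ c.support := fun i => c.getVert_mem_support i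
  have hne : ∀ i < c.length, f (c.getVert i) ≠ f (c.getVert (i + 1)) := fun i hi =>
    hf _ (hT _ (hmem _)) _ (hT _ (hmem _)) (c.adj_getVert_succ hi)
  have hskip : ∀ i, i + 1 < c.length → f (c.getVert (i + 2)) = f (c.getVert i) := by
    intro i hi
    have h1 := hne i (by omega)
    have h2 := hne (i + 1) hi
    have ha := hab _ (hmem i)
    have hb := hab _ (hmem (i + 1))
    have hd := hab _ (hmem (i + 2))
    simp only [add_assoc, Nat.reduceAdd] at h2
    rcases ha with ha | ha <;> rcases hb with hb | hb <;> rcases hd with hd | hd <;> simp_all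
  have halt : ∀ i ≤ c.length, f (c.getVert i) = if Even i then f v else f (c.getVert 1) := by
    intro i
    induction i using Nat.twoStepInduction with
    | zero => simp
    | one => simp
    | more n ih _ =>
      intro hn
      rw [hskip n (by omega), ih (by omega)]
      simp [Nat.even_add]
  have h01 : f v ≠ f (c.getVert 1) := by simpa using hne 0 (by omega)
  have heven : Even c.length := by
    by_contra hodd
    have := halt c.length le_rfl
    rw [if_neg hodd, Walk.getVert_length] at this
    exact h01 this
  obtain ⟨m, hm⟩ := heven
  have hnil := hc.not_nil
  have hlen : c.dropLast.length = 2 * (m - 2) + 3 := by rw [Walk.length_dropLast]; omega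
  have hget : ∀ i ≤ 2 * (m - 2) + 3, c.dropLast.getVert i = c.getVert i := fun i hi =>
    Walk.getVert_dropLast (by omega)
  have hpen : c.penultimate = c.getVert (2 * (m - 2) + 3) := by
    rw [← hget _ le_rfl, ← hlen, Walk.getVert_length]
  -- A cycle of length `2m` minus its last edge is a path of length `2m - 1 = 2(m - 2) + 3`.
  refine ⟨m - 2, ?_, ⟨_, c.dropLast⟩, mem_closablePaths.mpr
    ⟨hlen, hc.isPath_dropLast, c.adj_penultimate hnil⟩, ?_, ?_⟩
  · have := hc.isPath_dropLast.length_lt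
    omega
  · intro i
    refine hT _ ?_
    have h1 := c.dropLast.getVert_mem_support i
    obtain ⟨k, hk, hk'⟩ := Walk.mem_support_iff_exists_getVert.mp h1
    rw [← hk, hget k (by omega)]
    exact hmem k
  · intro i hi
    simp only
    rw [hget i hi, halt i (by omega), hpen, halt (2 * (m - 2) + 3) (by omega)]
    have : ¬ Even (2 * (m - 2) + 3) := by
      rw [Nat.not_even_iff_odd]; exact ⟨m - 2 + 1, by omega⟩
    rw [if_neg this]

variable [Fintype V] [Fintype α] [DecidableEq V]

open Classical in
/-- The acyclic colourings of `G` on `S`, with the value `z` outside of `S`. -/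
noncomputable def acyclicColoringsOn (G : SimpleGraph V) (z : α) (S : Finset V) :
    Finset (V → α) :=
  {f | G.IsAcyclicColoringOn S f ∧ ∀ x ∉ S, f x = z}

open Classical in
/-- The colourings on `insert v S` that are acyclic on `S`. -/
noncomputable def acyclicColoringsExt (G : SimpleGraph V) (z : α) (S : Finset V) (v : V) :
    Finset (V → α) :=
  {f | G.IsAcyclicColoringOn S f ∧ ∀ x ∉ insert v S, f x = z}

theorem mem_acyclicColoringsOn {z : α} {S : Finset V} {f : V → α} :
    f ∈ G.acyclicColoringsOn z S ↔ G.IsAcyclicColoringOn S f ∧ ∀ x ∉ S, f x = z := by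
  simp [acyclicColoringsOn]

theorem mem_acyclicColoringsExt {z : α} {S : Finset V} {v : V} {f : V → α} :
    f ∈ G.acyclicColoringsExt z S v ↔
      G.IsAcyclicColoringOn S f ∧ ∀ x ∉ insert v S, f x = z := by
  simp [acyclicColoringsExt]

theorem piecewise_mem_acyclicColoringsOn {z : α} {S T : Finset V} {f : V → α}
    (h : G.IsAcyclicColoringOn S f) (hTS : T ⊆ S) :
    (fun x => if x ∈ T then f x else z) ∈ G.acyclicColoringsOn z T := by
  rw [mem_acyclicColoringsOn]
  refine ⟨(h.mono hTS).congr fun x hx => by simp [hx], fun x hx => by simp [hx]⟩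

theorem card_acyclicColoringsOn_empty_pos (z : α) : 0 < #(G.acyclicColoringsOn z ∅) := by
  refine card_pos.mpr ⟨fun _ => z, mem_acyclicColoringsOn.mpr ⟨⟨by simp, ?_⟩, by simp⟩⟩
  intro u c hc hs
  exact absurd (hs u c.start_mem_support) (by simp)

theorem card_mul_card_acyclicColoringsOn_le (z : α) {S : Finset V} {v : V} (hv : v ∉ S) :
    Fintype.card α * #(G.acyclicColoringsOn z S) ≤ #(G.acyclicColoringsExt z S v) := by
  rw [← card_univ, ← card_product]
  refine card_le_card_of_injOn (fun p => Function.update p.2 v p.1) ?_ ?_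
  · rintro ⟨a, f⟩ hf
    have hf' := (mem_acyclicColoringsOn.mp (mem_product.mp (mem_coe.mp hf)).2)
    simp only at hf'
    refine mem_coe.mpr (mem_acyclicColoringsExt.mpr ⟨hf'.1.congr fun x hx => ?_, fun x hx => ?_⟩)
    · exact (Function.update_of_ne (ne_of_mem_of_not_mem hx hv) _ _).symm
    · simp only [mem_insert, not_or] at hx
      simp only
      rw [Function.update_of_ne hx.1]
      exact hf'.2 x hx.2
  · rintro ⟨a, f⟩ hf ⟨b, g⟩ hg h
    have hf' := (mem_acyclicColoringsOn.mp (mem_product.mp (mem_coe.mp hf)).2)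
    have hg' := (mem_acyclicColoringsOn.mp (mem_product.mp (mem_coe.mp hg)).2)
    simp only at h hf' hg'
    have h1 : a = b := by simpa using congrFun h v
    have h2 : f = g := by
      funext x
      by_cases hx : x = v
      · subst hx; rw [hf'.2 x hv, hg'.2 x hv]
      · simpa [hx] using congrFun h x
    rw [h1, h2]

open Classical in
-- The colour of `v` can be read off at `w`, so restriction to `S` is injective here.
theorem card_filter_eq_neighbor_le (z : α) {S : Finset V} {v w : V} (hw : w ∈ S) :
    #{f ∈ G.acyclicColoringsExt z S v | f v = f w} ≤ #(G.acyclicColoringsOn z S) := by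
  refine card_le_card_of_injOn (fun f x => if x ∈ S then f x else z) ?_ ?_
  · intro f hf
    have hf' := mem_acyclicColoringsExt.mp (mem_filter.mp (mem_coe.mp hf)).1
    exact mem_coe.mpr (piecewise_mem_acyclicColoringsOn hf'.1 subset_rfl)
  · intro f hf g hg h
    obtain ⟨hf1, hf2⟩ := mem_filter.mp (mem_coe.mp hf)
    obtain ⟨hg1, hg2⟩ := mem_filter.mp (mem_coe.mp hg)
    have hS : ∀ x ∈ S, f x = g x := fun x hx => by simpa [hx] using congrFun h x
    funext x
    by_cases hx : x ∈ S
    · exact hS x hx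
    by_cases hxv : x = v
    · rw [hxv, hf2, hg2, hS w hw]
    · have hx' : x ∉ insert v S := by simp [hx, hxv]
      rw [(mem_acyclicColoringsExt.mp hf1).2 x hx', (mem_acyclicColoringsExt.mp hg1).2 x hx']

open Classical in
-- The last two vertices of the path carry the two alternating colours, so they determine the
-- colours of `v` and of the `2j+1` vertices in between. Erasing these loses no information.
theorem card_filter_alternating_le [DecidableRel G.Adj] (z : α) {S : Finset V} {v : V} {j : ℕ} {p : Σ w, G.Walk v w} (hp : p ∈ G.closablePaths (2 * j + 3) v)
    (hpS : ∀ i, p.2.getVert i ∈ insert v S) :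
    ∃ R ⊆ S, #R = 2 * j + 1 ∧ #{f ∈ G.acyclicColoringsExt z S v |
      ∀ i ≤ 2 * j + 3, f (p.2.getVert i) = if Even i then f v else f p.1} ≤
        #(G.acyclicColoringsOn z (S \ R)) := by
  obtain ⟨w, p⟩ := p
  obtain ⟨hl, hpath, hadj⟩ := mem_closablePaths.mp hp
  simp only at hl hpath hadj hpS ⊢
  have hinj := hpath.getVert_injOn
  have hinj' : ∀ i j', i ≤ 2 * j + 3 → j' ≤ 2 * j + 3 → p.getVert i = p.getVert j' → i = j' :=
    fun i j' hi hj h => hinj (by simpa [hl] using hi) (by simpa [hl] using hj) h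
  have hpS' : ∀ i, 1 ≤ i → i ≤ 2 * j + 3 → p.getVert i ∈ S := by
    intro i h1 h2
    refine mem_of_mem_insert_of_ne (hpS i) fun h => ?_
    have := hinj' i 0 h2 (by omega) (by simpa using h)
    omega
  set R := (Icc 1 (2 * j + 1)).image p.getVert with hR
  have hRS : R ⊆ S := by
    intro x hx
    obtain ⟨i, hi, rfl⟩ := mem_image.mp hx
    rw [mem_Icc] at hi
    exact hpS' i hi.1 (by omega)
  have hRn : ∀ i, 2 * j + 1 < i → i ≤ 2 * j + 3 → p.getVert i ∈ S \ R := by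
    intro i h1 h2
    refine mem_sdiff.mpr ⟨hpS' i (by omega) h2, fun h => ?_⟩
    obtain ⟨k, hk, hk'⟩ := mem_image.mp h
    rw [mem_Icc] at hk
    have := hinj' k i (by omega) h2 hk'
    omega
  have hw : p.getVert (2 * j + 3) = w := by rw [← hl]; exact p.getVert_length
  refine ⟨R, hRS, ?_, ?_⟩
  · rw [hR, card_image_of_injOn, Nat.card_Icc]
    · omega
    · intro i hi k hk h
      simp only [coe_Icc, Set.mem_Icc] at hi hk
      exact hinj' i k (by omega) (by omega) h
  · refine card_le_card_of_injOn (fun f x => if x ∈ S \ R then f x else z) ?_ ?_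
    · intro f hf
      have hf' := mem_acyclicColoringsExt.mp (mem_filter.mp (mem_coe.mp hf)).1
      exact mem_coe.mpr (piecewise_mem_acyclicColoringsOn hf'.1 sdiff_subset)
    · intro f hf g hg h
      obtain ⟨hf1, hf2⟩ := mem_filter.mp (mem_coe.mp hf)
      obtain ⟨hg1, hg2⟩ := mem_filter.mp (mem_coe.mp hg)
      have hS : ∀ x ∈ S \ R, f x = g x := fun x hx => by
        have := congrFun h x
        simp only [if_pos hx] at this
        exact this
      have hfw : f w = g w := by
        rw [← hw]; exact hS _ (hRn _ (by omega) le_rfl)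
      have hfv : f v = g v := by
        -- Position `2j+2` is even and outside `R`, hence a surviving witness for the colour of `v`.
        have e : Even (2 * j + 2) := ⟨j + 1, by omega⟩
        have h1 := hf2 (2 * j + 2) (by omega)
        have h2 := hg2 (2 * j + 2) (by omega)
        rw [if_pos e] at h1 h2
        rw [← h1, ← h2]
        exact hS _ (hRn _ (by omega) (by omega))
      funext x
      by_cases hx : x ∈ S \ R
      · exact hS x hx
      by_cases hxR : x ∈ R
      · obtain ⟨i, hi, rfl⟩ := mem_image.mp hxR
        rw [mem_Icc] at hi
        rw [hf2 i (by omega), hg2 i (by omega), hfv, hfw]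
      by_cases hxv : x = v
      · rw [hxv, hfv]
      · have hx' : x ∉ insert v S := by
          simp only [mem_insert, not_or]
          exact ⟨hxv, fun h => hx (mem_sdiff.mpr ⟨h, hxR⟩)⟩
        rw [(mem_acyclicColoringsExt.mp hf1).2 x hx', (mem_acyclicColoringsExt.mp hg1).2 x hx']

open Classical in
-- A colouring that fails on `insert v S` but not on `S` has its conflict at `v`: a monochromatic
-- edge, or a bichromatic cycle, which can be rotated to start at `v`.
theorem acyclicColoringsExt_subset [DecidableRel G.Adj] (z : α) (S : Finset V) (v : V) :
    G.acyclicColoringsExt z S v ⊆ G.acyclicColoringsOn z (insert v S) ∪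
      (({w ∈ G.neighborFinset v | w ∈ S}.biUnion fun w =>
        {f ∈ G.acyclicColoringsExt z S v | f v = f w}) ∪
      (range (Fintype.card V)).biUnion fun j =>
        {p ∈ G.closablePaths (2 * j + 3) v | ∀ i, p.2.getVert i ∈ insert v S}.biUnion fun p =>
          {f ∈ G.acyclicColoringsExt z S v |
            ∀ i ≤ 2 * j + 3, f (p.2.getVert i) = if Even i then f v else f p.1}) := by
  intro f hf
  have hf' := mem_acyclicColoringsExt.mp hf
  by_contra hcon
  simp only [mem_union, not_or, mem_biUnion, mem_filter, mem_range, not_exists, not_and,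
    mem_neighborFinset] at hcon
  obtain ⟨h1, h2, h3⟩ := hcon
  refine h1 (mem_acyclicColoringsOn.mpr ⟨?_, hf'.2⟩)
  have hproper : ∀ a ∈ insert v S, ∀ b ∈ insert v S, G.Adj a b → f a ≠ f b := by
    intro a ha b hb hab
    rcases mem_insert.mp ha with rfl | ha'
    · rcases mem_insert.mp hb with rfl | hb'
      · exact absurd hab (G.loopless.irrefl _)
      · exact h2 b ⟨hab, hb'⟩ hf
    · rcases mem_insert.mp hb with rfl | hb'
      · exact fun h => h2 a ⟨hab.symm, ha'⟩ hf h.symm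
      · exact hf'.1.1 a ha' b hb' hab
  refine ⟨hproper, fun u c hc hs a b => ?_⟩
  by_contra! hbi
  have hbi' : ∀ x ∈ c.support, f x = a ∨ f x = b := fun x hx => by
    by_cases h : f x = a
    · exact Or.inl h
    · exact Or.inr (hbi x hx h)
  by_cases hvc : v ∈ c.support
  · obtain ⟨j, hj, p, hp, hpS, hpf⟩ := exists_closablePath_of_bichromatic hproper (c.rotate v hvc)
      (hc.rotate hvc) (fun x hx => hs x (by simpa using hx)) a b
      (fun x hx => hbi' x (by simpa using hx))
    exact h3 j hj p ⟨hp, hpS⟩ hf hpf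
  · obtain ⟨x, hx, hxa, hxb⟩ := hf'.1.2 u c hc
      (fun x hx => mem_of_mem_insert_of_ne (hs x hx) (by rintro rfl; exact hvc hx)) a b
    exact (hbi' x hx).elim hxa hxb

/-- Iterates the one-vertex growth bound over the vertices of `R`. Only sets smaller than `S` are
used, so it is available inside the induction proving that bound. -/
theorem pow_mul_card_acyclicColoringsOn_sdiff_le {β : ℝ} (hβ : 0 < β) (z : α) {S : Finset V}
    (ih : ∀ T v, #T < #S → v ∉ T →
      β * #(G.acyclicColoringsOn z T) ≤ #(G.acyclicColoringsOn z (insert v T)))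
    (R : Finset V) (hR : R ⊆ S) :
    β ^ #R * #(G.acyclicColoringsOn z (S \ R)) ≤ #(G.acyclicColoringsOn z S) := by
  induction R using Finset.induction_on with
  | empty => simp
  | insert a R ha ihR =>
    have haS : a ∈ S := hR (mem_insert_self _ _)
    have h1 := ih (S \ insert a R) a
      (card_lt_card (Finset.ssubset_iff_subset_ne.mpr ⟨sdiff_subset, fun h => by
        have := h ▸ haS
        simp at this⟩)) (by simp)
    have h2 : insert a (S \ insert a R) = S \ R := by
      ext x; simp only [mem_insert, mem_sdiff, not_or]
      constructor
      · rintro (rfl | h)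
        · exact ⟨haS, ha⟩
        · exact ⟨h.1, h.2.2⟩
      · intro h
        by_cases hx : x = a
        · exact Or.inl hx
        · exact Or.inr ⟨h.1, hx, h.2⟩
    rw [h2] at h1
    rw [card_insert_of_notMem ha, pow_succ, mul_assoc]
    exact (mul_le_mul_of_nonneg_left h1 (by positivity)).trans
      (ihR ((subset_insert _ _).trans hR))

variable [DecidableRel G.Adj] {D : ℕ} {β : ℝ} {B : ℕ → ℝ}

theorem mul_card_acyclicColoringsOn_le (hD : ∀ v, G.degree v ≤ D) (hβ : 0 < β)
    (hB : ∀ j v, (#(G.closablePaths (2 * j + 3) v) : ℝ) ≤ B j)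
    (hα : D + β + ∑ j ∈ range (Fintype.card V), B j / β ^ (2 * j + 1) ≤ Fintype.card α)
    (z : α) (S : Finset V) (v : V) (hv : v ∉ S) :
    β * #(G.acyclicColoringsOn z S) ≤ #(G.acyclicColoringsOn z (insert v S)) := by
  classical
  induction hm : #S using Nat.strong_induction_on generalizing S v with
  | _ m ih =>
    have ih' : ∀ T v, #T < #S → v ∉ T →
        β * #(G.acyclicColoringsOn z T) ≤ #(G.acyclicColoringsOn z (insert v T)) :=
      fun T v hT hv => ih _ (hm ▸ hT) T v hv rfl
    set N : ℝ := ((#(G.acyclicColoringsOn z S) : ℕ) : ℝ) with hN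
    have h0 : (Fintype.card α : ℝ) * N ≤ #(G.acyclicColoringsExt z S v) := by
      rw [hN]; exact_mod_cast card_mul_card_acyclicColoringsOn_le z hv
    have h1 := (card_le_card (acyclicColoringsExt_subset (G := G) z S v)).trans
      ((card_union_le _ _).trans (Nat.add_le_add_left (card_union_le _ _) _))
    have h2 : (#({w ∈ G.neighborFinset v | w ∈ S}.biUnion fun w =>
        {f ∈ G.acyclicColoringsExt z S v | f v = f w}) : ℝ) ≤ D * N := by
      have : #({w ∈ G.neighborFinset v | w ∈ S}.biUnion fun w =>
        {f ∈ G.acyclicColoringsExt z S v | f v = f w}) ≤ D * #(G.acyclicColoringsOn z S) := by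
        refine (card_biUnion_le_card_mul _ _ #(G.acyclicColoringsOn z S) fun w hw =>
          card_filter_eq_neighbor_le z (mem_filter.mp hw).2).trans ?_
        exact Nat.mul_le_mul_right _ ((card_filter_le _ _).trans (hD v))
      rw [hN]; exact_mod_cast this
    have h3 : (#((range (Fintype.card V)).biUnion fun j =>
        {p ∈ G.closablePaths (2 * j + 3) v | ∀ i, p.2.getVert i ∈ insert v S}.biUnion fun p =>
          {f ∈ G.acyclicColoringsExt z S v |
            ∀ i ≤ 2 * j + 3, f (p.2.getVert i) = if Even i then f v else f p.1}) : ℝ) ≤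
        (∑ j ∈ range (Fintype.card V), B j / β ^ (2 * j + 1)) * N := by
      refine (Nat.cast_le.mpr card_biUnion_le).trans ?_
      rw [Nat.cast_sum, sum_mul]
      refine sum_le_sum fun j _ => ?_
      refine (Nat.cast_le.mpr card_biUnion_le).trans ?_
      rw [Nat.cast_sum]
      refine (sum_le_card_nsmul _ _ (N / β ^ (2 * j + 1)) fun p hp => ?_).trans ?_
      · obtain ⟨hp1, hp2⟩ := mem_filter.mp hp
        -- By induction, restoring the `2j+1` erased vertices multiplies the count by at least
        -- `β^(2j+1)`, so each path spoils at most `N / β^(2j+1)` colourings.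
        obtain ⟨R, hRS, hRc, hR⟩ := card_filter_alternating_le z hp1 hp2
        have := pow_mul_card_acyclicColoringsOn_sdiff_le hβ z ih' R hRS
        rw [hRc] at this
        rw [le_div_iff₀ (by positivity), mul_comm]
        exact (mul_le_mul_of_nonneg_left (Nat.cast_le.mpr hR) (by positivity)).trans this
      · rw [nsmul_eq_mul, div_mul_eq_mul_div, ← mul_div_assoc]
        have hN0 : 0 ≤ N := Nat.cast_nonneg _
        gcongr
        exact (Nat.cast_le.mpr (card_filter_le _ _)).trans (hB j v)
    have h1' : (#(G.acyclicColoringsExt z S v) : ℝ) ≤ _ := Nat.cast_le.mpr h1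
    push_cast at h1'
    have h4 : (D + β + ∑ j ∈ range (Fintype.card V), B j / β ^ (2 * j + 1)) * N ≤
        Fintype.card α * N := mul_le_mul_of_nonneg_right hα (Nat.cast_nonneg _)
    rw [add_mul, add_mul] at h4
    linarith

/-- The counting criterion for acyclic colourability. -/
theorem acyclicColorable_of_sum_le (hD : ∀ v, G.degree v ≤ D) (hβ : 0 < β)
    (hB : ∀ j v, (#(G.closablePaths (2 * j + 3) v) : ℝ) ≤ B j) {k : ℕ} (hk : 0 < k)
    (hα : D + β + ∑ j ∈ range (Fintype.card V), B j / β ^ (2 * j + 1) ≤ k) :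
    G.AcyclicColorable k := by
  have z : Fin k := ⟨0, hk⟩
  -- Growth from the empty set to `univ` gives at least `β^#V` colourings.
  have hpos : 0 < #(G.acyclicColoringsOn z univ) := by
    have := pow_mul_card_acyclicColoringsOn_sdiff_le (G := G) hβ z (S := univ)
      (fun T v _ hv => mul_card_acyclicColoringsOn_le hD hβ hB (by simpa using hα) z T v hv)
      univ subset_rfl
    rw [sdiff_self] at this
    have h0 : (0 : ℝ) < #(G.acyclicColoringsOn z ∅) := by
      exact_mod_cast card_acyclicColoringsOn_empty_pos z
    have h1 : (0 : ℝ) < #(G.acyclicColoringsOn z univ) := lt_of_lt_of_le (by positivity) this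
    exact_mod_cast h1
  obtain ⟨f, hf⟩ := card_pos.mp hpos
  have hf' := (mem_acyclicColoringsOn.mp hf).1
  exact ⟨Coloring.mk f fun {a b} hab => hf'.1 a (mem_univ _) b (mem_univ _) hab,
    IsAcyclicColoringOn.isAcyclicColoring hf'⟩

end Counting

end SimpleGraph

/-! ### Choice of constants -/

namespace SimpleGraph

open Finset

theorem acyclicChromaticNumber_le_of_acyclicColorable {V : Type*} {G : SimpleGraph V} {k : ℕ}
    (h : G.AcyclicColorable k) : G.acyclicChromaticNumber ≤ k :=
  Nat.sInf_le h

/-- The four-cycle term is `2s²/(2s) = s`. For `j ≥ 1`, `D⁵ ≤ s⁴` and `D² ≤ s²` bound the term by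
`(s/2) 4^(-j)`. The full geometric series gives `2s/3`, and the `s/2` still missing at `j = 0` makes
`7s/6`. -/
theorem sum_div_pow_le {s D : ℝ} (hs : 0 < s) (hD : 1 ≤ D) (h : D ^ 5 ≤ s ^ 4) (n : ℕ) :
    ∑ j ∈ range n, (if j = 0 then 2 * s ^ 2 else D ^ (2 * j + 3)) / (2 * s) ^ (2 * j + 1) ≤
      7 / 6 * s := by
  have hDs : D ^ 2 ≤ s ^ 2 := by
    have h4 : (D ^ 2) ^ 2 ≤ (s ^ 2) ^ 2 := by
      calc (D ^ 2) ^ 2 = D ^ 4 := by ring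
        _ ≤ D ^ 5 := pow_le_pow_right₀ hD (by norm_num)
        _ ≤ s ^ 4 := h
        _ = _ := by ring
    exact (sq_le_sq₀ (by positivity) (by positivity)).mp h4
  have key : ∀ j ∈ range n,
      (if j = 0 then 2 * s ^ 2 else D ^ (2 * j + 3)) / (2 * s) ^ (2 * j + 1) ≤
        s / 2 * (1 / 4) ^ j + if j = 0 then s / 2 else 0 := by
    intro j _
    rcases j with _ | j
    · simp only [if_true, mul_zero, zero_add, pow_one, pow_zero, mul_one]
      rw [div_le_iff₀ (by positivity)]
      nlinarith
    · rw [if_neg (by omega), if_neg (by omega), add_zero, div_le_iff₀ (by positivity)]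
      calc D ^ (2 * (j + 1) + 3) = D ^ 5 * (D ^ 2) ^ j := by ring
        _ ≤ s ^ 4 * (s ^ 2) ^ j := by gcongr
        _ = s / 2 * (1 / 4) ^ (j + 1) * (2 * s) ^ (2 * (j + 1) + 1) := by
          have : (2 * s) ^ (2 * (j + 1) + 1) = 8 * 4 ^ j * s ^ 3 * (s ^ 2) ^ j := by
            rw [show (4 : ℝ) = 2 ^ 2 by norm_num, ← pow_mul]
            ring
          rw [this, pow_succ, div_pow, one_pow]
          field_simp
          ring
  refine (sum_le_sum key).trans ?_
  rw [sum_add_distrib, ← mul_sum]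
  have h1 : ∑ j ∈ range n, (1 / 4 : ℝ) ^ j ≤ 4 / 3 := by
    rw [geom_sum_eq (by norm_num), div_le_iff_of_neg (by norm_num)]
    have : (0 : ℝ) ≤ (1 / 4) ^ n := by positivity
    linarith
  have h2 : ∑ j ∈ range n, (if j = 0 then s / 2 else 0) ≤ s / 2 := by
    rw [sum_ite_eq' (range n) 0]
    split_ifs
    · exact le_rfl
    · positivity
  nlinarith

theorem Free.acyclicChromaticNumber_lt {W V : Type*} [Fintype W] [Fintype V] {F : SimpleGraph W}
    {G : SimpleGraph V} [DecidableRel G.Adj] (hF : F.Free G) (hbip : F.IsBipartite)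
    (hac : F.IsKAcyclic 2) (hW : 1 ≤ Fintype.card W) (hWD : Fintype.card W ≤ G.maxDegree) :
    (G.acyclicChromaticNumber : ℝ) <
      4.3948 * (Fintype.card W : ℝ) ^ (1 / 4 : ℝ) * (G.maxDegree : ℝ) ^ (5 / 4 : ℝ)
        + G.maxDegree := by
  classical
  set D := G.maxDegree with hDdef
  set t := Fintype.card W with ht
  have ht1 : (1 : ℝ) ≤ t := by exact_mod_cast hW
  have hD1 : (1 : ℝ) ≤ D := by exact_mod_cast hW.trans hWD
  set s : ℝ := (t : ℝ) ^ (1 / 4 : ℝ) * (D : ℝ) ^ (5 / 4 : ℝ) with hs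
  have hs1 : 1 ≤ s := one_le_mul_of_one_le_of_one_le (Real.one_le_rpow ht1 (by norm_num))
    (Real.one_le_rpow hD1 (by norm_num))
  have hs4 : s ^ 4 = t * (D : ℝ) ^ 5 := by
    rw [hs, mul_pow, ← Real.rpow_natCast, ← Real.rpow_natCast, ← Real.rpow_mul (by positivity),
      ← Real.rpow_mul (by positivity), ← Real.rpow_natCast (D : ℝ) 5]
    norm_num
  have hD5 : (D : ℝ) ^ 5 ≤ s ^ 4 := by
    rw [hs4]; exact le_mul_of_one_le_left (by positivity) ht1
  have hdeg : ∀ v, G.degree v ≤ D := fun v => G.degree_le_maxDegree v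
  have hB : ∀ j v, (#(G.closablePaths (2 * j + 3) v) : ℝ) ≤
      if j = 0 then 2 * s ^ 2 else (D : ℝ) ^ (2 * j + 3) := by
    intro j v
    split_ifs with hj
    · subst hj
      have h1 : (#(G.fourCycleTriples v) : ℝ) ^ 2 ≤ 4 * t * D ^ 5 := by
        exact_mod_cast hF.card_fourCycleTriples_sq_le hbip hac hW hWD hdeg v
      have h2 : (#(G.closablePaths 3 v) : ℝ) ≤ #(G.fourCycleTriples v) := by
        exact_mod_cast card_closablePaths_three_le v
      refine h2.trans ((sq_le_sq₀ (by positivity) (by positivity)).mp ?_)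
      calc _ ≤ 4 * (t : ℝ) * D ^ 5 := h1
        _ = 4 * (t * (D : ℝ) ^ 5) := by ring
        _ = (2 * s ^ 2) ^ 2 := by rw [← hs4]; ring
    · exact_mod_cast card_closablePaths_le hdeg (2 * j + 3) v
  have hcol : G.AcyclicColorable ⌈(D : ℝ) + 19 / 6 * s⌉₊ := by
    refine acyclicColorable_of_sum_le hdeg (β := 2 * s) (by positivity) hB
      (Nat.ceil_pos.mpr (by positivity)) (le_trans ?_ (Nat.le_ceil _))
    have := sum_div_pow_le (by positivity) hD1 hD5 (Fintype.card V)
    linarith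
  have h1 : (G.acyclicChromaticNumber : ℝ) ≤ ⌈(D : ℝ) + 19 / 6 * s⌉₊ := by
    exact_mod_cast acyclicChromaticNumber_le_of_acyclicColorable hcol
  -- Here `β = 2s`, so `2 + 7/6 = 19/6`. As `s ≥ 1`, rounding up costs at most another `s`, and
  -- `25/6 < 4.3948`; no error term is left.
  have h2 := Nat.ceil_lt_add_one (a := (D : ℝ) + 19 / 6 * s) (by positivity)
  rw [mul_assoc, ← hs]
  linarith

theorem Free.acyclicChromaticNumber_le {W V : Type*} [Fintype W] [Fintype V] {F : SimpleGraph W}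
    {G : SimpleGraph V} [DecidableRel G.Adj] (hF : F.Free G) (hbip : F.IsBipartite)
    (hac : F.IsKAcyclic 2) (hW : 1 ≤ Fintype.card W) (hWD : Fintype.card W ≤ G.maxDegree) :
    (G.acyclicChromaticNumber : ℝ) ≤
      6 * (Fintype.card W : ℝ) ^ (1 / 4 : ℝ) * (G.maxDegree : ℝ) ^ (5 / 4 : ℝ) := by
  have h := hF.acyclicChromaticNumber_lt hbip hac hW hWD
  have ht1 : (1 : ℝ) ≤ Fintype.card W := by exact_mod_cast hW
  have hD1 : (1 : ℝ) ≤ G.maxDegree := by exact_mod_cast hW.trans hWD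
  have h1 : (G.maxDegree : ℝ) ≤
      (Fintype.card W : ℝ) ^ (1 / 4 : ℝ) * (G.maxDegree : ℝ) ^ (5 / 4 : ℝ) :=
    (Real.self_le_rpow_of_one_le hD1 (by norm_num)).trans
      (le_mul_of_one_le_left (by positivity) (Real.one_le_rpow ht1 (by norm_num)))
  rw [mul_assoc] at h ⊢
  linarith

/-! ### The graphs `K_{3,s}` and the main theorem -/

theorem completeBipartiteGraph_isBipartite (α β : Type*) :
    (completeBipartiteGraph α β).IsBipartite :=
  ⟨Coloring.mk (fun x => if x.isLeft then 0 else 1) (by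
    rintro (a | a) (b | b) h <;> simp at h ⊢)⟩

/-- A graph all of whose edges meet a fixed vertex is acyclic. -/
theorem isAcyclic_of_forall_adj_eq {V : Type*} {G : SimpleGraph V} (x : V)
    (h : ∀ a b, G.Adj a b → a = x ∨ b = x) : G.IsAcyclic := by
  intro u c hc
  have h3 := hc.three_le_length
  have h01 := h _ _ (c.adj_getVert_succ (i := 0) (by omega))
  have h12 := h _ _ (c.adj_getVert_succ (i := 1) (by omega))
  have h23 := h _ _ (c.adj_getVert_succ (i := 2) (by omega))
  have hinj := hc.getVert_injOn
  have hinj' := hc.getVert_injOn'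
  have n12 : c.getVert 1 ≠ c.getVert 2 := fun e => by
    have := @hinj 1 ⟨by omega, by omega⟩ 2 ⟨by omega, by omega⟩ e; omega
  have n13 : c.getVert 1 ≠ c.getVert 3 := fun e => by
    have := @hinj 1 ⟨by omega, by omega⟩ 3 ⟨by omega, by omega⟩ e; omega
  have n02 : c.getVert 0 ≠ c.getVert 2 := fun e => by
    have := @hinj' 0 (by simp) 2 (by simp; omega) e; omega
  simp only [zero_add, Nat.reduceAdd] at h01 h12 h23
  rcases h12 with e | e
  · rcases h23 with e' | e'
    · exact n12 (e.trans e'.symm)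
    · exact n13 (e.trans e'.symm)
  · rcases h01 with e' | e'
    · exact n02 (e'.trans e.symm)
    · exact n12 (e'.trans e.symm)

theorem completeBipartiteGraph_three_isKAcyclic_two (s : ℕ) :
    (completeBipartiteGraph (Fin 3) (Fin s)).IsKAcyclic 2 := by
  -- Removing two of the three vertices on the small side leaves a star.
  refine ⟨{Sum.inl 0, Sum.inl 1}, by simp, ?_⟩
  refine isAcyclic_of_forall_adj_eq ⟨Sum.inl 2, by simp⟩ ?_
  rintro ⟨a | a, ha⟩ ⟨b | b, hb⟩ h
  · simp at h
  · left; fin_cases a <;> simp at ha ⊢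
  · right; fin_cases b <;> simp at hb ⊢
  · simp at h

end SimpleGraph

theorem mainTheorem6 :
    -- the bound `O(t^{1/4} Δ^{5/4})`, with an absolute constant
    (∃ C : ℝ, 0 < C ∧
      ∀ (W : Type u) [Fintype W] (F : SimpleGraph W)
        (V : Type v) [Fintype V] (G : SimpleGraph V) [DecidableRel G.Adj],
        2 ≤ Fintype.card W → F.IsBipartite → F.IsKAcyclic 2 →
        F.Free G → Fintype.card W < G.maxDegree →
        (G.acyclicChromaticNumber : ℝ) ≤
          C * (Fintype.card W : ℝ) ^ (1 / 4 : ℝ) * (G.maxDegree : ℝ) ^ (5 / 4 : ℝ)) ∧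
    -- the explicit bound, with an error term `o(Δ)` that depends on `Δ` only
    (∃ g : ℕ → ℝ, Asymptotics.IsLittleO Filter.atTop g (fun n : ℕ => (n : ℝ)) ∧
      ∀ (W : Type u) [Fintype W] (F : SimpleGraph W)
        (V : Type v) [Fintype V] (G : SimpleGraph V) [DecidableRel G.Adj],
        2 ≤ Fintype.card W → F.IsBipartite → F.IsKAcyclic 2 →
        F.Free G → Fintype.card W < G.maxDegree →
        (G.acyclicChromaticNumber : ℝ) <
          4.3948 * (Fintype.card W : ℝ) ^ (1 / 4 : ℝ) * (G.maxDegree : ℝ) ^ (5 / 4 : ℝ)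
            + (G.maxDegree : ℝ) + g G.maxDegree) ∧
    -- the complete bipartite graphs `K_{3,s}` are covered
    (∀ s : ℕ, (completeBipartiteGraph (Fin 3) (Fin s)).IsBipartite ∧
      (completeBipartiteGraph (Fin 3) (Fin s)).IsKAcyclic 2) ∧
    (∃ C : ℝ, 0 < C ∧
      ∀ s : ℕ, 1 ≤ s →
      ∀ (V : Type v) [Fintype V] (G : SimpleGraph V) [DecidableRel G.Adj],
        (completeBipartiteGraph (Fin 3) (Fin s)).Free G → s + 3 < G.maxDegree →
        (G.acyclicChromaticNumber : ℝ) ≤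
          C * (s : ℝ) ^ (1 / 4 : ℝ) * (G.maxDegree : ℝ) ^ (5 / 4 : ℝ)) := by
  -- The factor `4^(1/4)` comes from `s + 3 ≤ 4s`.
  refine ⟨⟨6, by norm_num, ?_⟩, ⟨fun _ => 0, Asymptotics.isLittleO_zero _ _, ?_⟩, fun s =>
    ⟨SimpleGraph.completeBipartiteGraph_isBipartite _ _,
      SimpleGraph.completeBipartiteGraph_three_isKAcyclic_two s⟩,
    ⟨6 * 4 ^ (1 / 4 : ℝ), by positivity, ?_⟩⟩
  · intro W _ F V _ G _ hW hbip hac hF hWD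
    exact hF.acyclicChromaticNumber_le hbip hac (by omega) hWD.le
  · intro W _ F V _ G _ hW hbip hac hF hWD
    rw [add_zero]
    exact hF.acyclicChromaticNumber_lt hbip hac (by omega) hWD.le
  · intro s hs V _ G _ hF hsD
    have hcard : Fintype.card (Fin 3 ⊕ Fin s) = s + 3 := by simp [add_comm]
    refine (hF.acyclicChromaticNumber_le (SimpleGraph.completeBipartiteGraph_isBipartite _ _)
      (SimpleGraph.completeBipartiteGraph_three_isKAcyclic_two s) (by omega) (by omega)).trans ?_
    rw [hcard, mul_assoc 6 (4 ^ (1 / 4 : ℝ)), ← Real.mul_rpow (by norm_num) (by positivity)]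
    have hs' : (1 : ℝ) ≤ s := by exact_mod_cast hs
    gcongr
    push_cast
    linarith
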